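/- Let $m\ge 2$, and let $\mathcal Q=\{[x]\in\mathbb{RP}^{2m} : q(x)=0\}$ be a non-degenerate quadric. Let $P:\mathbb Z^2\to\mathbb{RP}^{2m}$ be a Q-net inscribed in $\mathcal Q$, i.e. all points $P_{i,j}$ lie on $\mathcal Q$ and, for all $i,j$, the points $P_{i,j},P_{i+1,j},P_{i+1,j+1},P_{i,j+1}$ are coplanar. Let $V_i$ ($i\in\mathbb Z$) and $H_j$ ($j\in\mathbb Z$) be $m$-dimensional projective subspaces with $P_{i,j}\in V_i\cap H_j$ for all $i,j$. Assume that the net is generic in the following sense: (a) no three of the four points $P_{i,j},P_{i+1,j},P_{i+1,j+1},P_{i,j+1}$ are collinear, for all $i,j$; (b) for all $i,j$, the $m+1$ points $P_{i,j},P_{i,j+1},\dots,P_{i,j+m}$ span an $m$-dimensional subspace, and so do the $m+1$ points $P_{i,j},P_{i+1,j},\dots,P_{i+m,j}$; (c) the points $P_{i,j}$, $(i,j)\in\mathbb Z^2$, span $\mathbb{RP}^{2m}$; (d) none of the lines $P_{i,j}\vee P_{i,j+1}$ and $P_{i,j}\vee P_{i+1,j}$ is contained in $\mathcal Q$; (e)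 for all $i$ and $j$, each of the intersections $V_i\cap V_{i+1}\cap\dots\cap V_{i+m}$ and $H_j\cap H_{j+1}\cap\dots\cap H_{j+m}$ is a single point. Then there are quadrics $\mathcal V$ and $\mathcal H$ in $\mathbb{RP}^{2m}$ such that: 1. $\mathcal V$ has signature $(m,m,1)$ ($m$ plus signs, $m$ minus signs, one zero), and all $V_i$ are isotropic subspaces of $\mathcal V$, i.e. are contained in $\mathcal V$. 2. $\mathcal H$ has signature $(m,m,1)$, and all $H_j$ are isotropic subspaces of $\mathcal H$. 3. $\mathcal V$ has exactly two systems of generators; all $V_{2i}$, $i\in\mathbb Z$, belong to one of them, and all $V_{2i+1}$, $i\in\mathbb Z$, belong to the other one. 4. $\mathcal H$ has exactly two systems of generators; all $H_{2j}$, $j\in\mathbb Z$, belong to one of them, and all $H_{2j+1}$, $j\in\mathbb Z$, belong to the other one. 5. $\mathcal Q$, $\mathcal V$ and $\mathcal H$ belong to one pencil of quadrics, i.e. the quadratic forms that define them lie in a common two-dimensional linear space of quadratic forms. Here a generator of a quadric is an isotropic subspace of maximal dimension. Two generators $G_1,G_2$ of a quadric of signature $(m,m,1)$ in $\mathbb{RP}^{2m}$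 belong to the same system if, for a hyperplane $E$ that does not contain the singular point (apex) of the quadric, the dimension of $G_1\cap G_2\cap E$ (with $\dim\emptyset=-1$) has different parity than $m$; this does not depend on $E$. A system of generators consists of all generators that belong to the same system as a given one. -/

import Mathlib

open scoped LinearAlgebra.Projectivization

/-- The vector space `ℝⁿ⁺¹` whose projectivization is `ℝPⁿ`. -/
abbrev HomCoord (n : ℕ) : Type := Fin (n + 1) → ℝ

/-- Real projective space `ℝPⁿ`. -/
abbrev RP (n : ℕ) : Type := ℙ ℝ (HomCoord n)

/-- A projective subspace of `ℝPⁿ` is given by the linear subspace `S` of `ℝⁿ⁺¹` over it; its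
projective dimension is `dim S - 1` (so `-1` for the empty subspace). Joins and intersections of
projective subspaces are `⊔` and `⊓` of linear subspaces; a point `p` is the line `p.submodule`. -/
noncomputable def projDim {n : ℕ} (S : Submodule ℝ (HomCoord n)) : ℤ :=
  (Module.finrank ℝ S : ℤ) - 1

/-- A Q-net: for each elementary quadrilateral, the four vertices are coplanar. -/
def IsQNet {n : ℕ} (P : ℤ → ℤ → RP n) : Prop :=
  ∀ i j : ℤ, projDim ((P i j).submodule ⊔ (P (i + 1) j).submodule ⊔
    (P (i + 1) (j + 1)).submodule ⊔ (P i (j + 1)).submodule) ≤ 2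

/-- The projective subspace `G` is contained in the quadric `{[x] | q x = 0}`. A point `p` lies on
the quadric iff `IsIsotropic q p.submodule`. -/
def IsIsotropic {n : ℕ} (q : QuadraticForm ℝ (HomCoord n)) (G : Submodule ℝ (HomCoord n)) : Prop :=
  ∀ x ∈ G, q x = 0

/-- The quadric of `q` has signature `(p, s, r)`: `p` plus signs, `s` minus signs, `r` zeros. -/
def HasSignature {n : ℕ} (q : QuadraticForm ℝ (HomCoord n)) (p s r : ℕ) : Prop :=
  sigPos q = p ∧ sigNeg q = s ∧
    Module.finrank ℝ (QuadraticMap.radical q) = r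

/-- A generator of a quadric: an isotropic subspace of maximal dimension. -/
def IsGenerator {n : ℕ} (q : QuadraticForm ℝ (HomCoord n)) (G : Submodule ℝ (HomCoord n)) : Prop :=
  IsIsotropic q G ∧ ∀ G' : Submodule ℝ (HomCoord n), IsIsotropic q G' → projDim G' ≤ projDim G

/-- For generators `G₁`, `G₂` of a quadric of signature `(m, m, 1)` in `ℝP²ᵐ`: they belong to the
same system if, cutting with a hyperplane `E` that does not contain the apex (the singular point)
of the quadric, the dimension of the intersection of the generators `G₁ ∩ E` and `G₂ ∩ E` of the
neutral quadric in `E` has different parity than `m`. -/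
def SameSystem {m : ℕ} (q : QuadraticForm ℝ (HomCoord (2 * m)))
    (G₁ G₂ : Submodule ℝ (HomCoord (2 * m))) : Prop :=
  ∀ E : Submodule ℝ (HomCoord (2 * m)), IsCompl E (QuadraticMap.radical q) →
    ¬ projDim ((G₁ ⊓ E) ⊓ (G₂ ⊓ E)) ≡ (m : ℤ) [ZMOD 2]

/-- A system of generators of a quadric of signature `(m, m, 1)`: all the generators that belong to
the same system as some given generator. -/
def IsGeneratorSystem {m : ℕ} (q : QuadraticForm ℝ (HomCoord (2 * m)))
    (S : Set (Submodule ℝ (HomCoord (2 * m)))) : Prop :=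
  ∃ G, IsGenerator q G ∧ S = {G' | IsGenerator q G' ∧ SameSystem q G G'}

/-- The quadric of `q` has exactly two systems of generators; the even-indexed members of the
family `G` belong to one of them and the odd-indexed members to the other one. -/
def AlternatesBetweenSystems {m : ℕ} (q : QuadraticForm ℝ (HomCoord (2 * m)))
    (G : ℤ → Submodule ℝ (HomCoord (2 * m))) : Prop :=
  ∃ S₀ S₁ : Set (Submodule ℝ (HomCoord (2 * m))),
    IsGeneratorSystem q S₀ ∧ IsGeneratorSystem q S₁ ∧ S₀ ≠ S₁ ∧
    (∀ S, IsGeneratorSystem q S → S = S₀ ∨ S = S₁) ∧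
    (∀ i : ℤ, G (2 * i) ∈ S₀) ∧ (∀ i : ℤ, G (2 * i + 1) ∈ S₁)

/-- A pencil of quadrics: a projective line in the projective space of all quadrics, given by a
two-dimensional linear space of quadratic forms. -/
def IsPencil {n : ℕ} (L : Submodule ℝ (QuadraticForm ℝ (HomCoord n))) : Prop :=
  Module.finrank ℝ L = 2

/-- Genericity of a Q-net `P` in `ℝP²ᵐ` that is inscribed in the quadric of `q`, with parameter
lines in the subspaces `V i` and `H j`. -/
structure IsGenericNet {m : ℕ} (q : QuadraticForm ℝ (HomCoord (2 * m))) (P : ℤ → ℤ → RP (2 * m))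
    (V H : ℤ → Submodule ℝ (HomCoord (2 * m))) : Prop where
  /-- No three vertices of an elementary quadrilateral are collinear. -/
  quad₁ : ∀ i j : ℤ, projDim ((P i j).submodule ⊔ (P (i + 1) j).submodule ⊔
    (P i (j + 1)).submodule) = 2
  quad₂ : ∀ i j : ℤ, projDim ((P i j).submodule ⊔ (P (i + 1) j).submodule ⊔
    (P (i + 1) (j + 1)).submodule) = 2
  quad₃ : ∀ i j : ℤ, projDim ((P i j).submodule ⊔ (P i (j + 1)).submodule ⊔
    (P (i + 1) (j + 1)).submodule) = 2
  quad₄ : ∀ i j : ℤ, projDim ((P (i + 1) j).submodule ⊔ (P i (j + 1)).submodule ⊔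
    (P (i + 1) (j + 1)).submodule) = 2
  /-- Any `m + 1` consecutive vertices of a parameter line span an `m`-dimensional subspace. -/
  join_V : ∀ i j : ℤ, projDim (⨆ k : Fin (m + 1), (P i (j + (k : ℕ))).submodule) = m
  join_H : ∀ i j : ℤ, projDim (⨆ k : Fin (m + 1), (P (i + (k : ℕ)) j).submodule) = m
  /-- The vertices of `P` span `ℝP²ᵐ`. -/
  span_eq_top : (⨆ (i : ℤ) (j : ℤ), (P i j).submodule) = ⊤
  /-- The edge lines of `P` are not isotropic lines of the quadric. -/
  edge_V : ∀ i j : ℤ, ¬ IsIsotropic q ((P i j).submodule ⊔ (P i (j + 1)).submodule)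
  edge_H : ∀ i j : ℤ, ¬ IsIsotropic q ((P i j).submodule ⊔ (P (i + 1) j).submodule)
  /-- Any `m + 1` consecutive subspaces of each of the two families meet in a single point. -/
  inter_V : ∀ i : ℤ, projDim (⨅ k : Fin (m + 1), V (i + (k : ℕ))) = 0
  inter_H : ∀ j : ℤ, projDim (⨅ k : Fin (m + 1), H (j + (k : ℕ))) = 0

/-! ### Parity of the intersections of three self-orthogonal subspaces. -/

section Parity

open Module

variable {E : Type*} [AddCommGroup E] [Module ℝ E] {β : LinearMap.BilinForm ℝ E}

/-! Choose representatives `p i j`, and let `β` be the polar form of `Q`. The net propagates from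
one row and one column, so `V i + H j` is the whole space, and by dimension `V i ∩ H j` is the line
of `p i j`. As `p i j` is isotropic, `β (p i j)` kills this line. It is therefore uniquely a sum of
a functional `φ i j` killing `V i` and one killing `H j` (`exists_isSplitting`).

The core is that `p i j ↦ φ i j` extends to a linear map `Φ : E → E*`. The `φ i j` satisfy the same
quadrilateral relations as the `p i j` (`IsSplitting.rel`), so the pairs `(p i j, φ i j)` form a net
in `E × E*`. A vertical vector `(0, θ)` in the span of one row travels to every row, hence `θ` kills
every `V k` and is zero. It follows that the span of all pairs is the graph of `Φ`
(`IsSplitting.exists_form`). This `Φ` is symmetric, vanishes on each `V i` and equals `β` on each `H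
j`. Hence `Φ` gives `𝒱`, the difference `Q - 𝒱` is `ℋ`, and the pencil is immediate.

The rest concerns one family. Edges joining consecutive subspaces are not isotropic, so a kernel
vector in `V 0` lies in all later `V k`. The one-point intersection then forces corank one
(`finrank_ker_eq_one`), and isotropic spaces of dimension `m + 1` fix the signature. Consecutive `V
i` meet in dimension `m`, so the parity lemma `finrank_inf_add_finrank_inf_modEq` makes them
alternate between exactly two systems. -/

theorem LinearMap.BilinForm.orthogonal_sup (β : LinearMap.BilinForm ℝ E) (A B : Submodule ℝ E) :
    β.orthogonal (A ⊔ B) = β.orthogonal A ⊓ β.orthogonal B := by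
  apply le_antisymm
  · exact le_inf (orthogonal_le le_sup_left) (orthogonal_le le_sup_right)
  · rintro x ⟨hA, hB⟩ y hy
    obtain ⟨a, ha, b, hb, rfl⟩ := Submodule.mem_sup.1 hy
    have h1 : β a x = 0 := hA a ha
    have h2 : β b x = 0 := hB b hb
    change β (a + b) x = 0
    simp [h1, h2]

theorem LinearMap.BilinForm.ker_le_orthogonal (hβ : β.IsSymm) (W : Submodule ℝ E) :
    LinearMap.ker β ≤ β.orthogonal W := by
  intro x hx y _
  change β y x = 0
  rw [hβ.eq, LinearMap.mem_ker.1 hx]; rfl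

variable [FiniteDimensional ℝ E]

/-- The rank of an alternating bilinear form is even. -/
theorem LinearMap.BilinForm.IsAlt.exists_finrank_eq_finrank_ker_add {ω : LinearMap.BilinForm ℝ E}
    (hω : ω.IsAlt) : ∃ k : ℕ, finrank ℝ E = finrank ℝ (LinearMap.ker ω) + 2 * k := by
  obtain ⟨W, hW⟩ := Submodule.exists_isCompl (LinearMap.ker ω)
  have hneg : ∀ x y, ω x y = - ω y x := fun x y => (hω.neg_eq y x).symm
  have hsep : ∀ w : W, (∀ w' : W, ω w w' = 0) → w = 0 := by
    intro w hw
    have hker : (w : E) ∈ LinearMap.ker ω := by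
      rw [LinearMap.mem_ker]
      ext y
      obtain ⟨k, hk, w', hw', rfl⟩ := Submodule.mem_sup.1
        (show y ∈ LinearMap.ker ω ⊔ W by rw [hW.sup_eq_top]; trivial)
      have h1 : ω w k = 0 := by
        rw [hneg, LinearMap.mem_ker.1 hk]; simp
      simpa [h1] using hw ⟨w', hw'⟩
    have := hW.disjoint.le_bot ⟨hker, w.2⟩
    exact Subtype.ext ((Submodule.mem_bot ℝ).1 this)
  let b := finBasis ℝ W
  let A : Matrix (Fin (finrank ℝ W)) (Fin (finrank ℝ W)) ℝ :=
    LinearMap.BilinForm.toMatrix b (ω.restrict W)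
  have hA : A.transpose = -A := by
    ext i j
    simp only [A, Matrix.transpose_apply, Matrix.neg_apply, LinearMap.BilinForm.toMatrix_apply,
      LinearMap.BilinForm.restrict_apply, LinearMap.domRestrict_apply]
    exact hneg _ _
  have hdet : A.det ≠ 0 := by
    have : (ω.restrict W).SeparatingLeft := fun w hw => hsep w hw
    exact Matrix.separatingLeft_iff_det_ne_zero.1
      ((LinearMap.BilinForm.separatingLeft_toMatrix_iff b).2 this)
  have hW2 : Even (finrank ℝ W) := by
    -- The Gram matrix on a complement of the radical is skew and invertible; in odd size skewness
    -- would give `det = -det`.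
    by_contra hodd
    rw [Nat.not_even_iff_odd] at hodd
    have h := congrArg Matrix.det hA
    rw [Matrix.det_transpose, Matrix.det_neg, Fintype.card_fin, hodd.neg_one_pow] at h
    apply hdet
    linarith
  obtain ⟨k, hk⟩ := hW2
  refine ⟨k, ?_⟩
  rw [← Submodule.finrank_add_eq_of_isCompl hW]
  omega

theorem LinearMap.BilinForm.finrank_add_finrank_orthogonal_of_ker_le {W : Submodule ℝ E}
    (hW : LinearMap.ker β ≤ W) :
    finrank ℝ W + finrank ℝ (β.orthogonal W) = finrank ℝ E + finrank ℝ (LinearMap.ker β) := by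
  rw [finrank_add_finrank_orthogonal', inf_eq_right.2 hW]

theorem LinearMap.BilinForm.orthogonal_orthogonal_of_ker_le (hβ : β.IsSymm) {W : Submodule ℝ E}
    (hW : LinearMap.ker β ≤ W) : β.orthogonal (β.orthogonal W) = W := by
  refine (Submodule.eq_of_le_of_finrank_eq (le_orthogonal_orthogonal hβ.isRefl) ?_).symm
  have h1 := finrank_add_finrank_orthogonal_of_ker_le hW
  have h2 := finrank_add_finrank_orthogonal_of_ker_le (ker_le_orthogonal hβ W)
  omega

/-- The dimensions of the pairwise intersections of three subspaces that are their own orthogonal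
complements with respect to a symmetric bilinear form add up to the dimension of these subspaces,
modulo two. -/
theorem LinearMap.BilinForm.finrank_inf_add_finrank_inf_modEq (hβ : β.IsSymm)
    {A B C : Submodule ℝ E} (hA : β.orthogonal A = A) (hB : β.orthogonal B = B)
    (hC : β.orthogonal C = C) :
    finrank ℝ ↥(A ⊓ B) + finrank ℝ ↥(A ⊓ C) + finrank ℝ ↥(B ⊓ C) ≡ finrank ℝ A [MOD 2] := by
  have hkA : LinearMap.ker β ≤ A := hA ▸ ker_le_orthogonal hβ A
  have hkB : LinearMap.ker β ≤ B := hB ▸ ker_le_orthogonal hβ B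
  have hkC : LinearMap.ker β ≤ C := hC ▸ ker_le_orthogonal hβ C
  have oA : ∀ x ∈ A, ∀ y ∈ A, β x y = 0 := fun x hx y hy => by
    rw [← hA] at hy; exact hy x hx
  have oB : ∀ x ∈ B, ∀ y ∈ B, β x y = 0 := fun x hx y hy => by
    rw [← hB] at hy; exact hy x hx
  have oC : ∀ x ∈ C, ∀ y ∈ C, β x y = 0 := fun x hx y hy => by
    rw [← hC] at hy; exact hy x hx
  have hAC : β.orthogonal (A ⊓ C) = A ⊔ C := by
    rw [← orthogonal_orthogonal_of_ker_le hβ (hkA.trans (le_sup_left : A ≤ A ⊔ C)),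
      orthogonal_sup, hA, hC]
  have hBAC : β.orthogonal (B ⊓ (A ⊔ C)) = B ⊔ A ⊓ C := by
    rw [← orthogonal_orthogonal_of_ker_le hβ (hkB.trans (le_sup_left : B ≤ B ⊔ A ⊓ C)),
      orthogonal_sup, hB, hAC]
  -- On `D`, let `t` be a linear choice of `B`-component and put `ω x y = β x (t y)`. This form
  -- turns out to be alternating with kernel `A ⊓ B ⊔ A ⊓ C`, so its even rank yields the
  -- congruence.
  let D : Submodule ℝ E := A ⊓ (B ⊔ C)
  obtain ⟨t, htB, htC⟩ : ∃ t : D →ₗ[ℝ] E, (∀ x, t x ∈ B) ∧ ∀ x : D, (x : E) - t x ∈ C := by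
    let f : B × C →ₗ[ℝ] ↥(B ⊔ C) :=
      LinearMap.codRestrict (B ⊔ C) (B.subtype.coprod C.subtype) (by
        rintro ⟨b, c⟩
        exact Submodule.add_mem_sup b.2 c.2)
    have hf : LinearMap.range f = ⊤ := by
      rw [LinearMap.range_eq_top]
      rintro ⟨x, hx⟩
      obtain ⟨b, hb, c, hc, rfl⟩ := Submodule.mem_sup.1 hx
      exact ⟨(⟨b, hb⟩, ⟨c, hc⟩), Subtype.ext rfl⟩
    obtain ⟨g, hg⟩ := f.exists_rightInverse_of_surjective hf
    let ι : D →ₗ[ℝ] ↥(B ⊔ C) := Submodule.inclusion inf_le_right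
    refine ⟨B.subtype ∘ₗ LinearMap.fst ℝ B C ∘ₗ g ∘ₗ ι, fun x => (g (ι x)).1.2, fun x => ?_⟩
    have h1 : ((g (ι x)).1 : E) + (g (ι x)).2 = x :=
      congrArg Subtype.val (LinearMap.congr_fun hg (ι x))
    have h2 : (x : E) - (g (ι x)).1 = (g (ι x)).2 := by rw [← h1]; abel
    change (x : E) - (g (ι x)).1 ∈ C
    rw [h2]
    exact (g (ι x)).2.2
  let ω : LinearMap.BilinForm ℝ D := (β.compl₂ t) ∘ₗ D.subtype
  have hω : ∀ x y : D, ω x y = β x (t y) := fun _ _ => rfl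
  -- Expand `β (x - t x) (x - t x) = 0`, which holds in `C`; the square terms vanish in `A` and `B`.
  have halt : ω.IsAlt := by
    intro x
    have h := oC _ (htC x) _ (htC x)
    have hxx := oA _ x.2.1 _ x.2.1
    have htt := oB _ (htB x) _ (htB x)
    have hs : β (t x) x = β x (t x) := hβ.eq _ _
    simp only [map_sub, LinearMap.sub_apply] at h
    rw [hω]
    linarith
  obtain ⟨k, hk⟩ := halt.exists_finrank_eq_finrank_ker_add
  have hker : (LinearMap.ker ω).map D.subtype = A ⊓ B ⊔ A ⊓ C := by
    apply le_antisymm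
    · rintro _ ⟨x, hx, rfl⟩
      have hx' : ∀ y : D, β x (t y) = 0 := fun y => by
        rw [← hω, LinearMap.mem_ker.1 hx]; rfl
      -- For `b = a + c`, the vector `b - t a` lies in `B ⊓ C`, which is orthogonal to `x ∈ B ⊔ C`;
      -- and `β x (t a) = 0` because `x` is in the kernel. The modular law then gives the inclusion.
      have hmem : (x : E) ∈ β.orthogonal (B ⊓ (A ⊔ C)) := by
        rintro b ⟨hb, hb'⟩
        change β b x = 0
        obtain ⟨a, ha, c, hc, rfl⟩ := Submodule.mem_sup.1 hb'
        have haD : a ∈ D := ⟨ha, by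
          have := Submodule.sub_mem _ (Submodule.mem_sup_left (T := C) hb)
            (Submodule.mem_sup_right (S := B) hc)
          simpa using this⟩
        have h1 : a + c - t ⟨a, haD⟩ ∈ B := B.sub_mem hb (htB _)
        have h2 : a + c - t ⟨a, haD⟩ ∈ C := by
          have := C.add_mem (htC ⟨a, haD⟩) hc
          simpa [sub_add_eq_add_sub] using this
        obtain ⟨b₀, hb₀, c₀, hc₀, hx₀⟩ := Submodule.mem_sup.1 x.2.2
        have h3 : β x (a + c - t ⟨a, haD⟩) = 0 := by
          rw [← hx₀, map_add, LinearMap.add_apply, oB _ hb₀ _ h1, oC _ hc₀ _ h2, add_zero]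
        rw [hβ.eq, ← sub_add_cancel (a + c) (t ⟨a, haD⟩), map_add, h3, hx', add_zero]
      rw [hBAC] at hmem
      rw [sup_comm, inf_comm A B, ← sup_inf_assoc_of_le B (inf_le_left : A ⊓ C ≤ A), sup_comm]
      exact ⟨hmem, x.2.1⟩
    · refine sup_le ?_ ?_
      · rintro x ⟨hxA, hxB⟩
        refine ⟨⟨x, hxA, Submodule.mem_sup_left hxB⟩, ?_, rfl⟩
        refine LinearMap.mem_ker.2 (LinearMap.ext fun y => ?_)
        exact oB _ hxB _ (htB y)
      · rintro x ⟨hxA, hxC⟩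
        refine ⟨⟨x, hxA, Submodule.mem_sup_right hxC⟩, ?_, rfl⟩
        refine LinearMap.mem_ker.2 (LinearMap.ext fun y => ?_)
        have h1 := oC _ hxC _ (htC y)
        rw [map_sub, oA _ hxA _ y.2.1] at h1
        change β x (t y) = 0
        linarith
  -- With `n = dim A`, these identities give `dim D = n - dim (B ⊓ C) + dim (A ⊓ B ⊓ C)` and `dim
  -- ker ω = dim (A ⊓ B) + dim (A ⊓ C) - dim (A ⊓ B ⊓ C)`.
  have e0 : finrank ℝ (LinearMap.ker ω) = finrank ℝ ↥(A ⊓ B ⊔ A ⊓ C) := by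
    rw [← hker, Submodule.finrank_map_subtype_eq]
  have e1 := Submodule.finrank_sup_add_finrank_inf_eq (A ⊓ B) (A ⊓ C)
  have e2 := Submodule.finrank_sup_add_finrank_inf_eq A (B ⊔ C)
  have e3 := Submodule.finrank_sup_add_finrank_inf_eq B C
  have e4 := finrank_add_finrank_orthogonal_of_ker_le
    (hkA.trans (le_sup_left : A ≤ A ⊔ (B ⊔ C)))
  rw [orthogonal_sup, orthogonal_sup, hA, hB, hC] at e4
  have e5 := finrank_add_finrank_orthogonal_of_ker_le hkA
  have e6 := finrank_add_finrank_orthogonal_of_ker_le hkB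
  have e7 := finrank_add_finrank_orthogonal_of_ker_le hkC
  rw [hA] at e5; rw [hB] at e6; rw [hC] at e7
  have e8 : A ⊓ B ⊓ (A ⊓ C) = A ⊓ (B ⊓ C) := (inf_inf_distrib_left A B C).symm
  rw [e8] at e1
  change finrank ℝ ↥(A ⊓ (B ⊔ C)) = _ at hk
  unfold Nat.ModEq
  omega

end Parity

/-! ### Propagation along nets with planar quadrilaterals. -/

section Grid

/-- Coefficients, all of them non-zero, of linear dependencies between the vertices of the
elementary quadrilaterals of a net on `ℤ²`. -/
structure GridCoeffs where
  a : ℤ → ℤ → ℝ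
  b : ℤ → ℤ → ℝ
  c : ℤ → ℤ → ℝ
  d : ℤ → ℤ → ℝ
  a_ne : ∀ i j, a i j ≠ 0
  b_ne : ∀ i j, b i j ≠ 0
  c_ne : ∀ i j, c i j ≠ 0
  d_ne : ∀ i j, d i j ≠ 0

namespace GridCoeffs

variable {M : Type*} [AddCommGroup M] [Module ℝ M]

/-- The coefficients after the two directions of the grid are interchanged. -/
def swap (g : GridCoeffs) : GridCoeffs where
  a i j := g.a j i
  b i j := g.d j i
  c i j := g.c j i
  d i j := g.b j i
  a_ne i j := g.a_ne j i
  b_ne i j := g.d_ne j i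
  c_ne i j := g.c_ne j i
  d_ne i j := g.b_ne j i

/-- The vertices of each elementary quadrilateral of `f` satisfy the dependency given by `g`. -/
def Rel (g : GridCoeffs) (f : ℤ → ℤ → M) : Prop :=
  ∀ i j, g.a i j • f i j + g.b i j • f (i + 1) j + g.c i j • f (i + 1) (j + 1) +
    g.d i j • f i (j + 1) = 0

theorem Rel.swap {g : GridCoeffs} {f : ℤ → ℤ → M} (h : g.Rel f) :
    g.swap.Rel (fun i j => f j i) := by
  intro i j
  rw [← h j i]
  simp only [GridCoeffs.swap]
  abel

end GridCoeffs

variable {M : Type*} [AddCommGroup M] [Module ℝ M]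

/-- The span of the parameter line of `f` with first index `i`. -/
def rowSpan (f : ℤ → ℤ → M) (i : ℤ) : Submodule ℝ M := Submodule.span ℝ (Set.range (f i))

theorem mem_rowSpan (f : ℤ → ℤ → M) (i j : ℤ) : f i j ∈ rowSpan f i :=
  Submodule.subset_span ⟨j, rfl⟩

theorem rowSpan_le {f : ℤ → ℤ → M} {i : ℤ} {S : Submodule ℝ M} (h : ∀ j, f i j ∈ S) :
    rowSpan f i ≤ S :=
  Submodule.span_le.2 (by rintro _ ⟨j, rfl⟩; exact h j)

theorem rowSpan_apply_le {N : Type*} [AddCommGroup N] [Module ℝ N] (l : M →ₗ[ℝ] N)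
    (f : ℤ → ℤ → M) (i : ℤ) : rowSpan f i ≤ (rowSpan (fun i j => l (f i j)) i).comap l :=
  rowSpan_le fun j => mem_rowSpan (fun i j => l (f i j)) i j

/-- Modulo `S`, neighbouring terms are non-zero multiples of each other, so one term generates all
of them in both directions. -/
theorem mem_sup_span_singleton_of_chain {S : Submodule ℝ M} {x : ℤ → M} {u v : ℤ → ℝ}
    (hu : ∀ j, u j ≠ 0) (hv : ∀ j, v j ≠ 0) (h : ∀ j, u j • x j + v j • x (j + 1) ∈ S)
    (j k : ℤ) : x k ∈ S ⊔ Submodule.span ℝ {x j} := by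
  set T := S ⊔ Submodule.span ℝ {x j}
  have hT : ∀ j, u j • x j + v j • x (j + 1) ∈ T := fun j => Submodule.mem_sup_left (h j)
  induction k using Int.inductionOn' (b := j) with
  | zero => exact Submodule.mem_sup_right (Submodule.mem_span_singleton_self _)
  | succ k _ ih =>
    have := T.sub_mem (hT k) (T.smul_mem (u k) ih)
    rw [add_sub_cancel_left] at this
    exact (T.smul_mem_iff (hv k)).1 this
  | pred k _ ih =>
    have h1 := hT (k - 1)
    rw [sub_add_cancel] at h1
    have := T.sub_mem h1 (T.smul_mem (v (k - 1)) ih)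
    rw [add_sub_cancel_right] at this
    exact (T.smul_mem_iff (hu _)).1 this

namespace GridCoeffs

variable {g : GridCoeffs} {f : ℤ → ℤ → M}

/-- The quadrilateral relation equates, up to sign, a combination along one edge with one along the
opposite edge: this is where the two edge lines meet. -/
theorem Rel.edge_mem (h : g.Rel f) (i j : ℤ) :
    g.a i j • f i j + g.d i j • f i (j + 1) ∈ rowSpan f i ⊓ rowSpan f (i + 1) := by
  refine ⟨add_mem (Submodule.smul_mem _ _ (mem_rowSpan f i _))
    (Submodule.smul_mem _ _ (mem_rowSpan f i _)), ?_⟩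
  have : g.a i j • f i j + g.d i j • f i (j + 1) =
      -(g.b i j • f (i + 1) j + g.c i j • f (i + 1) (j + 1)) := by
    rw [eq_neg_iff_add_eq_zero, ← h i j]; abel
  rw [this]
  exact neg_mem (add_mem (Submodule.smul_mem _ _ (mem_rowSpan f _ _))
    (Submodule.smul_mem _ _ (mem_rowSpan f _ _)))

/-- A row is generated by its intersection with the next row and any single vertex. All later
transport between rows and all dimension counts for consecutive rows rest on this. -/
theorem Rel.rowSpan_le_sup (h : g.Rel f) (i j : ℤ) :
    rowSpan f i ≤ rowSpan f i ⊓ rowSpan f (i + 1) ⊔ Submodule.span ℝ {f i j} :=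
  rowSpan_le fun k => mem_sup_span_singleton_of_chain (g.a_ne i) (g.d_ne i)
    (fun j => h.edge_mem i j) j k

theorem Rel.rowSpan_succ_le_sup (h : g.Rel f) (i j : ℤ) :
    rowSpan f (i + 1) ≤ rowSpan f i ⊓ rowSpan f (i + 1) ⊔ Submodule.span ℝ {f (i + 1) j} := by
  refine rowSpan_le fun k => mem_sup_span_singleton_of_chain (g.b_ne i) (g.c_ne i)
    (fun j => ?_) j k
  have : g.b i j • f (i + 1) j + g.c i j • f (i + 1) (j + 1) =
      -(g.a i j • f i j + g.d i j • f i (j + 1)) := by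
    rw [eq_neg_iff_add_eq_zero, ← h i j]; abel
  rw [this]
  exact neg_mem (h.edge_mem i j)

/-- A net is contained in the span of any two of its parameter lines of different directions. -/
theorem Rel.mem_rowSpan_sup (h : g.Rel f) (i j k l : ℤ) :
    f k l ∈ rowSpan f i ⊔ rowSpan (fun i j => f j i) j := by
  set T := rowSpan f i ⊔ rowSpan (fun i j => f j i) j
  have hcol : ∀ k, f k j ∈ T := fun k =>
    Submodule.mem_sup_right (mem_rowSpan (fun i j => f j i) j k)
  suffices rowSpan f k ≤ T from this (mem_rowSpan f k l)
  induction k using Int.inductionOn' (b := i) with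
  | zero => exact le_sup_left
  | succ k _ ih =>
    refine (h.rowSpan_succ_le_sup k j).trans (sup_le (inf_le_left.trans ih) ?_)
    rw [Submodule.span_singleton_le_iff_mem]
    exact hcol _
  | pred k _ ih =>
    have h1 := h.rowSpan_le_sup (k - 1) j
    rw [sub_add_cancel] at h1
    refine h1.trans (sup_le (inf_le_right.trans ih) ?_)
    rw [Submodule.span_singleton_le_iff_mem]
    exact hcol _

end GridCoeffs

end Grid

/-! ### Transport of vertical vectors in a net lifted to a product. -/

section Lift

variable {E F : Type*} [AddCommGroup E] [Module ℝ E] [AddCommGroup F] [Module ℝ F]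
  {g : GridCoeffs} {p : ℤ → ℤ → E} {φ : ℤ → ℤ → F}

/-- The coefficient of `y` must vanish, since otherwise the first coordinate of `y` would lie in
`U`. -/
theorem mem_of_mem_sup_span_singleton {S : Submodule ℝ (E × F)} {U : Submodule ℝ E}
    {y z : E × F} (hS : S ≤ U.comap (LinearMap.fst ℝ E F)) (hy : y.1 ∉ U)
    (hz : z ∈ S ⊔ Submodule.span ℝ {y}) (hz0 : z.1 = 0) : z ∈ S := by
  obtain ⟨s, hs, w, hw, rfl⟩ := Submodule.mem_sup.1 hz
  obtain ⟨t, rfl⟩ := Submodule.mem_span_singleton.1 hw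
  have hsU : s.1 ∈ U := hS hs
  have ht : t = 0 := by
    by_contra ht
    refine hy ((U.smul_mem_iff ht).1 ?_)
    have : t • y.1 = -s.1 := by
      rw [eq_neg_iff_add_eq_zero, add_comm]; exact hz0
    rw [this]
    exact U.neg_mem hsU
  simpa [ht] using hs

/-- A linear dependency within one parameter line of `p` that is violated by `φ` is transported to
all parallel parameter lines. -/
theorem GridCoeffs.Rel.vertical_mem_rowSpan (h : g.Rel fun i j => (p i j, φ i j))
    (hp : ∀ i j, p i j ∉ rowSpan p (i + 1)) (hp' : ∀ i j, p (i + 1) j ∉ rowSpan p i)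
    {θ : F} {i : ℤ} (hθ : ((0 : E), θ) ∈ rowSpan (fun i j => (p i j, φ i j)) i) (k : ℤ) :
    ((0 : E), θ) ∈ rowSpan (fun i j => (p i j, φ i j)) k := by
  have hfst : ∀ i, rowSpan (fun i j => (p i j, φ i j)) i ≤
      (rowSpan p i).comap (LinearMap.fst ℝ E F) := fun i => rowSpan_apply_le _ _ i
  induction k using Int.inductionOn' (b := i) with
  | zero => exact hθ
  | succ k _ ih =>
    -- Row `k` lies in the span of row `k + 1` and one vertex of row `k`; the vertex drops out
    -- because `p k 0` is outside the span of row `k + 1` of `p`.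
    exact mem_of_mem_sup_span_singleton (hfst (k + 1)) (y := (p k 0, φ k 0)) (hp k 0)
      (sup_le_sup_right (inf_le_right : _ ⊓ rowSpan (fun i j => (p i j, φ i j)) (k + 1) ≤ _) _
        (h.rowSpan_le_sup k 0 ih)) rfl
  | pred k _ ih =>
    have h1 := h.rowSpan_succ_le_sup (k - 1) 0
    have h2 := hp' (k - 1) 0
    rw [sub_add_cancel] at h1 h2
    exact mem_of_mem_sup_span_singleton (hfst (k - 1)) (y := (p k 0, φ k 0)) h2
      (sup_le_sup_right (inf_le_left : rowSpan (fun i j => (p i j, φ i j)) (k - 1) ⊓ _ ≤ _) _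
        (h1 ih)) rfl

end Lift

/-! ### Splitting the form of an inscribed net along its two directions. -/

section InscribedNet

open Module

/-- A net of vectors `p` that are isotropic for a symmetric bilinear form, with planar elementary
quadrilaterals, non-isotropic edges, and parameter lines whose spans meet only in the vertices. -/
structure InscribedNet (E : Type*) [AddCommGroup E] [Module ℝ E] where
  coeffs : GridCoeffs
  form : LinearMap.BilinForm ℝ E
  p : ℤ → ℤ → E
  symm : ∀ x y, form x y = form y x
  rel : coeffs.Rel p
  isotropic : ∀ i j, form (p i j) (p i j) = 0
  edge_row : ∀ i j, form (p i j) (p i (j + 1)) ≠ 0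
  edge_col : ∀ i j, form (p i j) (p (i + 1) j) ≠ 0
  inf_le : ∀ i j, rowSpan p i ⊓ rowSpan (fun i j => p j i) j ≤ Submodule.span ℝ {p i j}
  span_eq_top : Submodule.span ℝ (Set.range fun z : ℤ × ℤ => p z.1 z.2) = ⊤

namespace InscribedNet

variable {E : Type*} [AddCommGroup E] [Module ℝ E]

/-- The net with its two directions interchanged. -/
def swap (N : InscribedNet E) : InscribedNet E where
  coeffs := N.coeffs.swap
  form := N.form
  p i j := N.p j i
  symm := N.symm
  rel := N.rel.swap
  isotropic i j := N.isotropic j i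
  edge_row i j := N.edge_col j i
  edge_col i j := N.edge_row j i
  inf_le i j := by rw [inf_comm]; exact N.inf_le j i
  span_eq_top := by
    rw [← N.span_eq_top, ← (Equiv.prodComm ℤ ℤ).surjective.range_comp]
    rfl

variable (N : InscribedNet E)

/-- The span of a parameter line with fixed first index. -/
def V (i : ℤ) : Submodule ℝ E := rowSpan N.p i

/-- The span of a parameter line with fixed second index. -/
def H (j : ℤ) : Submodule ℝ E := N.swap.V j

theorem mem_V (i j : ℤ) : N.p i j ∈ N.V i := mem_rowSpan N.p i j

theorem mem_H (i j : ℤ) : N.p i j ∈ N.H j := N.swap.mem_V j i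

theorem V_inf_H_le (i j : ℤ) : N.V i ⊓ N.H j ≤ Submodule.span ℝ {N.p i j} := N.inf_le i j

theorem V_sup_H (i j : ℤ) : N.V i ⊔ N.H j = ⊤ := by
  rw [eq_top_iff, ← N.span_eq_top, Submodule.span_le]
  rintro _ ⟨z, rfl⟩
  exact N.rel.mem_rowSpan_sup i j z.1 z.2

theorem V_le_sup (i j : ℤ) : N.V i ≤ N.V i ⊓ N.V (i + 1) ⊔ Submodule.span ℝ {N.p i j} :=
  N.rel.rowSpan_le_sup i j

theorem iSup_V : ⨆ i, N.V i = ⊤ := by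
  rw [eq_top_iff, ← N.span_eq_top, Submodule.span_le]
  rintro _ ⟨z, rfl⟩
  exact Submodule.mem_iSup_of_mem z.1 (N.mem_V z.1 z.2)

theorem form_eq_zero_of_mem_span {i j : ℤ} {x : E} (hx : x ∈ Submodule.span ℝ {N.p i j}) :
    N.form (N.p i j) x = 0 := by
  obtain ⟨t, rfl⟩ := Submodule.mem_span_singleton.1 hx
  simp [N.isotropic]

/-- Otherwise `p i j` would lie in `V (i + 1) ⊓ H j`, hence be a multiple of `p (i + 1) j`, and the
edge between them would be isotropic. -/
theorem notMem_V_succ (i j : ℤ) : N.p i j ∉ N.V (i + 1) := fun h => by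
  have := N.form_eq_zero_of_mem_span (N.V_inf_H_le (i + 1) j ⟨h, N.mem_H i j⟩)
  rw [N.symm] at this
  exact N.edge_col i j this

theorem succ_notMem_V (i j : ℤ) : N.p (i + 1) j ∉ N.V i := fun h =>
  N.edge_col i j (N.form_eq_zero_of_mem_span (N.V_inf_H_le i j ⟨h, N.mem_H (i + 1) j⟩))

theorem dual_ext {i j : ℤ} {φ φ' : Dual ℝ E} (hV : ∀ x ∈ N.V i, φ x = φ' x)
    (hH : ∀ x ∈ N.H j, φ x = φ' x) : φ = φ' := by
  ext x
  obtain ⟨v, hv, h, hh, rfl⟩ := Submodule.mem_sup.1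
    (show x ∈ N.V i ⊔ N.H j by rw [N.V_sup_H]; trivial)
  rw [map_add, map_add, hV v hv, hH h hh]

/-- The functionals `φ i j` vanish on `V i` and agree with the functional of `p i j` on `H j`. -/
structure IsSplitting (φ : ℤ → ℤ → Dual ℝ E) : Prop where
  apply_V : ∀ i j, ∀ x ∈ N.V i, φ i j x = 0
  apply_H : ∀ i j, ∀ x ∈ N.H j, φ i j x = N.form (N.p i j) x

/-- The annihilator of `V i ⊓ H j` is the sum of the two annihilators, and it contains the
functional of `p i j` because `p i j` is isotropic and spans the intersection. -/
theorem exists_isSplitting : ∃ φ, N.IsSplitting φ := by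
  have h : ∀ i j, ∃ φ : Dual ℝ E, (∀ x ∈ N.V i, φ x = 0) ∧
      ∀ x ∈ N.H j, φ x = N.form (N.p i j) x := by
    intro i j
    have hmem : N.form (N.p i j) ∈ (N.V i).dualAnnihilator ⊔ (N.H j).dualAnnihilator := by
      rw [← Subspace.dualAnnihilator_inf_eq, Submodule.mem_dualAnnihilator]
      exact fun x hx => N.form_eq_zero_of_mem_span (N.V_inf_H_le i j hx)
    obtain ⟨φ, hφ, ψ, hψ, hsum⟩ := Submodule.mem_sup.1 hmem
    refine ⟨φ, (Submodule.mem_dualAnnihilator φ).1 hφ, fun x hx => ?_⟩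
    rw [← hsum, LinearMap.add_apply, (Submodule.mem_dualAnnihilator ψ).1 hψ x hx, add_zero]
  choose φ hφ using h
  exact ⟨φ, fun i j => (hφ i j).1, fun i j => (hφ i j).2⟩

variable {N} {φ : ℤ → ℤ → Dual ℝ E}

/-- The complementary summands split the interchanged net, so results about rows carry over to
columns. -/
theorem IsSplitting.swap (hφ : N.IsSplitting φ) :
    N.swap.IsSplitting fun i j => N.form (N.p j i) - φ j i where
  apply_V i j x hx := by
    rw [LinearMap.sub_apply, hφ.apply_H j i x hx, sub_self]
  apply_H i j x hx := by
    rw [LinearMap.sub_apply, hφ.apply_V j i x hx, sub_zero]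
    rfl

variable (N) in
/-- In a planar quadrilateral inscribed in a quadric, the weighted products of the end points of
two opposite edges agree. -/
theorem form_opposite_edges (i j : ℤ) :
    N.coeffs.a i j * N.coeffs.b i j * N.form (N.p i j) (N.p (i + 1) j) =
      N.coeffs.c i j * N.coeffs.d i j * N.form (N.p (i + 1) (j + 1)) (N.p i (j + 1)) := by
  have h := fun x => congrArg (N.form x) (N.rel i j)
  simp only [map_add, map_smul, map_zero, smul_eq_mul] at h
  have h0 := h (N.p i j)
  have h1 := h (N.p (i + 1) j)
  have h2 := h (N.p (i + 1) (j + 1))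
  have h3 := h (N.p i (j + 1))
  rw [N.isotropic] at h0 h1 h2 h3
  rw [N.symm (N.p (i + 1) j) (N.p i j)] at h1
  rw [N.symm (N.p (i + 1) (j + 1)) (N.p i j), N.symm (N.p (i + 1) (j + 1)) (N.p (i + 1) j)] at h2
  rw [N.symm (N.p i (j + 1)) (N.p i j), N.symm (N.p i (j + 1)) (N.p (i + 1) j),
    N.symm (N.p i (j + 1)) (N.p (i + 1) (j + 1))] at h3
  -- With `X = a p + b p₁` and `Y = c p₁₂ + d p₂`, this is `0 = form (X - Y) (X + Y) = form X X -
  -- form Y Y`, where only the mixed terms of each square survive.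
  linear_combination (1 / 2) * (N.coeffs.a i j * h0 + N.coeffs.b i j * h1 -
    N.coeffs.c i j * h2 - N.coeffs.d i j * h3)

/-- The combination `θ` of the four functionals vanishes on `V i ⊓ V (i + 1)` term by term, and on
`H j ⊓ H (j + 1)` since there it is the form paired with the relation for `p`. Adding `p i j` to
these intersections gives `V i` and `H j`, so only `θ (p i j) = 0` needs the quadric. -/
theorem IsSplitting.rel (hφ : N.IsSplitting φ) : N.coeffs.Rel φ := by
  intro i j
  set a := N.coeffs.a i j
  set b := N.coeffs.b i j
  set c := N.coeffs.c i j
  set d := N.coeffs.d i j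
  have ha : a ≠ 0 := N.coeffs.a_ne i j
  set θ := a • φ i j + b • φ (i + 1) j + c • φ (i + 1) (j + 1) + d • φ i (j + 1) with hθ
  have hθx : ∀ x, θ x =
      a * φ i j x + b * φ (i + 1) j x + c * φ (i + 1) (j + 1) x + d * φ i (j + 1) x := by
    intro x; simp [hθ]
  have hp : θ (N.p i j) = 0 := by
    -- The value of `φ (i + 1) (j + 1)` at `p i j` is not given by the splitting; applying it to the
    -- relation for `p` reduces it to the edge product that `form_opposite_edges` compares.
    have h1 := congrArg (φ (i + 1) (j + 1)) (N.rel i j)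
    simp only [map_add, map_smul, map_zero, smul_eq_mul] at h1
    rw [hφ.apply_V _ _ _ (N.mem_V (i + 1) j), hφ.apply_V _ _ _ (N.mem_V (i + 1) (j + 1)),
      hφ.apply_H _ _ _ (N.mem_H i (j + 1))] at h1
    have h2 : a * θ (N.p i j) = 0 := by
      rw [hθx, hφ.apply_V _ _ _ (N.mem_V i j), hφ.apply_V i (j + 1) _ (N.mem_V i j),
        hφ.apply_H (i + 1) j _ (N.mem_H i j), N.symm]
      linear_combination c * h1 + N.form_opposite_edges i j
    exact (mul_eq_zero.1 h2).resolve_left ha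
  have key : ∀ S : Submodule ℝ E, (∀ x ∈ S, θ x = 0) →
      ∀ x ∈ S ⊔ Submodule.span ℝ {N.p i j}, θ x = 0 := by
    intro S hS x hx
    obtain ⟨s, hs, w, hw, rfl⟩ := Submodule.mem_sup.1 hx
    obtain ⟨t, rfl⟩ := Submodule.mem_span_singleton.1 hw
    rw [map_add, map_smul, hS s hs, hp, smul_zero, add_zero]
  refine N.dual_ext (i := i) (j := j) (fun x hx => ?_) (fun x hx => ?_)
  · refine key _ (fun y hy => ?_) x (N.V_le_sup i j hx)
    rw [hθx, hφ.apply_V i j y hy.1, hφ.apply_V i (j + 1) y hy.1, hφ.apply_V (i + 1) j y hy.2,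
      hφ.apply_V (i + 1) (j + 1) y hy.2]
    ring
  · refine key _ (fun y hy => ?_) x (N.swap.V_le_sup j i hx)
    have h1 := congrArg (fun z => N.form z y) (N.rel i j)
    simp only [map_add, map_smul, map_zero, smul_eq_mul, LinearMap.add_apply,
      LinearMap.smul_apply, LinearMap.zero_apply] at h1
    rw [hθx, hφ.apply_H i j y hy.1, hφ.apply_H i (j + 1) y hy.2, hφ.apply_H (i + 1) j y hy.1,
      hφ.apply_H (i + 1) (j + 1) y hy.2, h1]

theorem IsSplitting.rel_prod (hφ : N.IsSplitting φ) :
    N.coeffs.Rel fun i j => (N.p i j, φ i j) := fun i j =>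
  Prod.ext (by simpa using N.rel i j) (by simpa using hφ.rel i j)

/-- A vertical vector in one lifted row lies in all of them, so its functional annihilates every `V
k`, and these span `E`. -/
theorem IsSplitting.eq_zero_of_mem_rowSpan (hφ : N.IsSplitting φ) {i : ℤ} {z : E × Dual ℝ E}
    (hz : z ∈ rowSpan (fun i j => (N.p i j, φ i j)) i) (hz0 : z.1 = 0) : z = 0 := by
  obtain ⟨x, θ⟩ := z
  obtain rfl : x = 0 := hz0
  have hk : ∀ k, N.V k ≤ LinearMap.ker θ := by
    intro k
    have h1 := hφ.rel_prod.vertical_mem_rowSpan N.notMem_V_succ N.succ_notMem_V hz k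
    have h2 : rowSpan (fun i j => (N.p i j, φ i j)) k ≤
        ((N.V k).dualAnnihilator).comap (LinearMap.snd ℝ E (Dual ℝ E)) :=
      rowSpan_le fun j => (Submodule.mem_dualAnnihilator _).2 (hφ.apply_V k j)
    exact fun x hx => (Submodule.mem_dualAnnihilator _).1 (h2 h1) x hx
  have : θ = 0 := by
    rw [← LinearMap.ker_eq_top, eq_top_iff, ← N.iSup_V]
    exact iSup_le hk
  rw [this]
  rfl

/-- The map `(x, ξ) ↦ (x, form x - ξ)` turns lifted columns into lifted rows of the interchanged net
and fixes vertical vectors up to sign. -/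
theorem IsSplitting.eq_zero_of_mem_colSpan (hφ : N.IsSplitting φ) {j : ℤ} {z : E × Dual ℝ E}
    (hz : z ∈ rowSpan (fun j i => (N.p i j, φ i j)) j) (hz0 : z.1 = 0) : z = 0 := by
  let l : E × Dual ℝ E →ₗ[ℝ] E × Dual ℝ E :=
    (LinearMap.fst ℝ E (Dual ℝ E)).prod
      (N.form ∘ₗ LinearMap.fst ℝ E (Dual ℝ E) - LinearMap.snd ℝ E (Dual ℝ E))
  have hl : l z ∈ rowSpan (fun j i => (N.p i j, N.form (N.p i j) - φ i j)) j :=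
    rowSpan_apply_le l (fun j i => (N.p i j, φ i j)) j hz
  have h1 : l z = 0 := IsSplitting.eq_zero_of_mem_rowSpan (N := N.swap) hφ.swap hl hz0
  have h2 : N.form z.1 - z.2 = 0 := congrArg Prod.snd h1
  rw [hz0, map_zero, zero_sub, neg_eq_zero] at h2
  exact Prod.ext hz0 h2

/-- A vertical vector is a sum from one lifted row and one lifted column. Their first coordinates
are opposite, hence multiples of `p 0 0`; shifting both summands by a multiple of the common lifted
vertex makes each vertical. -/
theorem IsSplitting.eq_zero_of_mem_span (hφ : N.IsSplitting φ) {z : E × Dual ℝ E}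
    (hz : z ∈ Submodule.span ℝ (Set.range fun k : ℤ × ℤ => (N.p k.1 k.2, φ k.1 k.2)))
    (hz0 : z.1 = 0) : z = 0 := by
  have hle : Submodule.span ℝ (Set.range fun k : ℤ × ℤ => (N.p k.1 k.2, φ k.1 k.2)) ≤
      rowSpan (fun i j => (N.p i j, φ i j)) 0 ⊔ rowSpan (fun j i => (N.p i j, φ i j)) 0 := by
    rw [Submodule.span_le]
    rintro _ ⟨k, rfl⟩
    exact hφ.rel_prod.mem_rowSpan_sup 0 0 k.1 k.2
  obtain ⟨r, hr, s, hs, rfl⟩ := Submodule.mem_sup.1 (hle hz)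
  have hr1 : r.1 ∈ N.V 0 := rowSpan_apply_le (LinearMap.fst ℝ E (Dual ℝ E)) _ 0 hr
  have hs1 : s.1 ∈ N.H 0 := rowSpan_apply_le (LinearMap.fst ℝ E (Dual ℝ E)) _ 0 hs
  have hrs : r.1 = -s.1 := eq_neg_of_add_eq_zero_left hz0
  obtain ⟨t, ht⟩ := Submodule.mem_span_singleton.1
    (N.V_inf_H_le 0 0 ⟨hr1, hrs ▸ neg_mem hs1⟩)
  have h1 : r - t • (N.p 0 0, φ 0 0) = 0 :=
    hφ.eq_zero_of_mem_rowSpan (i := 0) (sub_mem hr (Submodule.smul_mem _ _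
      (mem_rowSpan (fun i j => (N.p i j, φ i j)) 0 0))) (by simp [ht])
  have h2 : s + t • (N.p 0 0, φ 0 0) = 0 :=
    hφ.eq_zero_of_mem_colSpan (j := 0) (add_mem hs (Submodule.smul_mem _ _
      (mem_rowSpan (fun j i => (N.p i j, φ i j)) 0 0))) (by simp [ht, hrs])
  calc r + s = (r - t • (N.p 0 0, φ 0 0)) + (s + t • (N.p 0 0, φ 0 0)) := by abel
    _ = 0 := by rw [h1, h2, add_zero]

/-- The span of the pairs projects bijectively to `E`, so it is the graph of a linear map to the
dual. -/
theorem IsSplitting.exists_form (hφ : N.IsSplitting φ) :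
    ∃ Φ : LinearMap.BilinForm ℝ E, ∀ i j, Φ (N.p i j) = φ i j := by
  set Γ := Submodule.span ℝ (Set.range fun k : ℤ × ℤ => (N.p k.1 k.2, φ k.1 k.2)) with hΓ
  have hbij : Function.Bijective (Prod.fst ∘ Γ.subtype) := by
    constructor
    · intro x y hxy
      have := hφ.eq_zero_of_mem_span (sub_mem x.2 y.2)
        (show ((x : E × Dual ℝ E) - y).1 = 0 from sub_eq_zero.2 hxy)
      exact Subtype.ext (sub_eq_zero.1 this)
    · intro x
      have hle : (⊤ : Submodule ℝ E) ≤ Γ.map (LinearMap.fst ℝ E (Dual ℝ E)) := by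
        rw [← N.span_eq_top, Submodule.span_le]
        rintro _ ⟨k, rfl⟩
        exact ⟨_, Submodule.subset_span ⟨k, rfl⟩, rfl⟩
      obtain ⟨y, hy, hyx⟩ := hle (Submodule.mem_top (x := x))
      exact ⟨⟨y, hy⟩, hyx⟩
  obtain ⟨Φ, hΦ⟩ := Submodule.exists_eq_graph hbij
  refine ⟨Φ, fun i j => ?_⟩
  have hmem : (N.p i j, φ i j) ∈ Γ := Submodule.subset_span ⟨(i, j), rfl⟩
  rw [hΦ, LinearMap.mem_graph_iff] at hmem
  exact hmem.symm

theorem form_ext {Φ Ψ : LinearMap.BilinForm ℝ E} (h : ∀ i j, Φ (N.p i j) = Ψ (N.p i j)) :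
    Φ = Ψ := by
  refine LinearMap.ext_on N.span_eq_top ?_
  rintro _ ⟨k, rfl⟩
  exact h k.1 k.2

variable (N) in
/-- The form of an inscribed net splits into a symmetric form that vanishes on the parameter lines
of one direction and one that vanishes on the parameter lines of the other direction. -/
theorem exists_symmetric_form : ∃ Φ : LinearMap.BilinForm ℝ E, (∀ x y, Φ x y = Φ y x) ∧
    (∀ i, ∀ x ∈ N.V i, ∀ y ∈ N.V i, Φ x y = 0) ∧
    ∀ j, ∀ x ∈ N.H j, ∀ y ∈ N.H j, Φ x y = N.form x y := by
  obtain ⟨φ, hφ⟩ := N.exists_isSplitting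
  obtain ⟨Φ, hΦ⟩ := hφ.exists_form
  have hV : ∀ i, ∀ x ∈ N.V i, ∀ y ∈ N.V i, Φ x y = 0 := by
    intro i x hx y hy
    have : N.V i ≤ LinearMap.ker (LinearMap.flip Φ y) := rowSpan_le fun j => by
      rw [LinearMap.mem_ker, LinearMap.flip_apply, hΦ, hφ.apply_V i j y hy]
    exact this hx
  have hH : ∀ j, ∀ x ∈ N.H j, ∀ y ∈ N.H j, Φ x y = N.form x y := by
    intro j x hx y hy
    have : N.H j ≤ LinearMap.ker (LinearMap.flip Φ y - LinearMap.flip N.form y) := rowSpan_le fun i => by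
      rw [LinearMap.mem_ker, LinearMap.sub_apply, LinearMap.flip_apply, LinearMap.flip_apply]
      change Φ (N.p i j) y - N.form (N.p i j) y = 0
      rw [hΦ, hφ.apply_H i j y hy, sub_self]
    exact sub_eq_zero.1 (this hx)
  refine ⟨Φ, ?_, hV, hH⟩
  -- Against `p i j`, both forms are zero on `V i` and equal to `form` on `H j`; these two subspaces
  -- span `E`.
  have hflip : Φ = LinearMap.flip Φ := by
    refine N.form_ext fun i j => N.dual_ext (i := i) (j := j) (fun x hx => ?_) (fun x hx => ?_)
    · rw [LinearMap.flip_apply, hV i _ (N.mem_V i j) x hx, hV i x hx _ (N.mem_V i j)]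
    · rw [LinearMap.flip_apply, hH j _ (N.mem_H i j) x hx, hH j x hx _ (N.mem_H i j), N.symm]
  intro x y
  conv_lhs => rw [hflip]
  rfl

end InscribedNet

end InscribedNet

/-! ### Corank one, and dimensions of isotropic subspaces. -/

section Corank

open Module

variable {E : Type*} [AddCommGroup E] [Module ℝ E] {m : ℕ}
  {β : LinearMap.BilinForm ℝ E} {W : Submodule ℝ E}

theorem LinearMap.BilinForm.le_orthogonal_self (hW : ∀ x ∈ W, ∀ y ∈ W, β x y = 0) :
    W ≤ β.orthogonal W :=
  fun y hy x hx => hW x hx y hy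

/-- Write a kernel vector of `V i` as an element of `V i ⊓ V (i + 1)` plus `t • p i 0`. Pairing with
`p (i + 1) 0` leaves `t` times a non-zero edge product, so `t = 0`. -/
theorem InscribedNet.mem_V_of_mem_ker (N : InscribedNet E) {Φ : LinearMap.BilinForm ℝ E}
    (hV : ∀ i, ∀ x ∈ N.V i, ∀ y ∈ N.V i, Φ x y = 0)
    (hedge : ∀ i j, Φ (N.p i j) (N.p (i + 1) j) ≠ 0) {x : E} (hx : x ∈ LinearMap.ker Φ)
    {i : ℤ} (hxi : x ∈ N.V i) (k : ℕ) : x ∈ N.V (i + k) := by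
  induction k with
  | zero => simpa using hxi
  | succ k ih =>
    obtain ⟨u, hu, w, hw, rfl⟩ := Submodule.mem_sup.1 (N.V_le_sup (i + k) 0 ih)
    obtain ⟨t, rfl⟩ := Submodule.mem_span_singleton.1 hw
    have h1 : Φ (u + t • N.p (i + k) 0) (N.p (i + k + 1) 0) = 0 := by
      rw [LinearMap.mem_ker.1 hx]; rfl
    rw [map_add, LinearMap.add_apply, hV _ u hu.2 _ (N.mem_V _ 0), map_smul,
      LinearMap.smul_apply, zero_add, smul_eq_mul] at h1
    have ht : t = 0 := (mul_eq_zero.1 h1).resolve_right (hedge _ 0)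
    rw [ht, zero_smul, add_zero]
    have := hu.2
    push_cast
    rwa [← add_assoc]

variable [FiniteDimensional ℝ E]

theorem LinearMap.BilinForm.finrank_le_of_isotropic (hE : finrank ℝ E = 2 * m + 1)
    (hker : finrank ℝ (LinearMap.ker β) = 1) (hW : ∀ x ∈ W, ∀ y ∈ W, β x y = 0) :
    finrank ℝ W ≤ m + 1 := by
  have h1 := finrank_add_finrank_orthogonal' (B := β) W
  have h2 := Submodule.finrank_mono (le_orthogonal_self hW)
  have h3 := Submodule.finrank_mono (inf_le_right : W ⊓ LinearMap.ker β ≤ LinearMap.ker β)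
  omega

theorem LinearMap.BilinForm.orthogonal_eq_self_of_isotropic (hE : finrank ℝ E = 2 * m + 1)
    (hker : finrank ℝ (LinearMap.ker β) = 1) (hW : ∀ x ∈ W, ∀ y ∈ W, β x y = 0)
    (hWm : finrank ℝ W = m + 1) : β.orthogonal W = W := by
  refine (Submodule.eq_of_le_of_finrank_le (le_orthogonal_self hW) ?_).symm
  have h1 := finrank_add_finrank_orthogonal' (B := β) W
  have h3 := Submodule.finrank_mono (inf_le_right : W ⊓ LinearMap.ker β ≤ LinearMap.ker β)
  omega

theorem finrank_sup_span_singleton_of_notMem {S : Submodule ℝ E} {x : E} (hx : x ∉ S) :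
    finrank ℝ ↥(S ⊔ Submodule.span ℝ {x}) = finrank ℝ S + 1 := by
  have hx0 : x ≠ 0 := fun h => hx (h ▸ S.zero_mem)
  have h1 := Submodule.finrank_sup_add_finrank_inf_eq S (Submodule.span ℝ {x})
  have h2 : S ⊓ Submodule.span ℝ {x} = ⊥ := by
    rw [← disjoint_iff]
    exact (Submodule.disjoint_span_singleton' hx0).2 hx
  rw [h2, finrank_bot, finrank_span_singleton hx0] at h1
  omega

namespace InscribedNet

variable (N : InscribedNet E)

theorem finrank_V_inf_V_succ {i : ℤ} (hV : finrank ℝ (N.V i) = m + 1) :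
    finrank ℝ ↥(N.V i ⊓ N.V (i + 1)) = m := by
  have h1 : N.V i = N.V i ⊓ N.V (i + 1) ⊔ Submodule.span ℝ {N.p i 0} := by
    refine le_antisymm (N.V_le_sup i 0) (sup_le inf_le_left ?_)
    rw [Submodule.span_singleton_le_iff_mem]
    exact N.mem_V i 0
  have h2 : N.p i 0 ∉ N.V i ⊓ N.V (i + 1) := fun h => N.notMem_V_succ i 0 h.2
  have h3 := finrank_sup_span_singleton_of_notMem h2
  rw [← h1] at h3
  omega

/-- The part `r` of the kernel inside `V 0` has dimension at most one. The orthogonal complement of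
`V 0` has dimension `m + r` and contains `V 0`, so `r = 1` and the two coincide; the whole kernel is
therefore inside `V 0`. -/
theorem finrank_ker_eq_one {Φ : LinearMap.BilinForm ℝ E} (hE : finrank ℝ E = 2 * m + 1)
    (hsymm : ∀ x y, Φ x y = Φ y x)
    (hV : ∀ i, ∀ x ∈ N.V i, ∀ y ∈ N.V i, Φ x y = 0)
    (hedge : ∀ i j, Φ (N.p i j) (N.p (i + 1) j) ≠ 0) (hVm : finrank ℝ (N.V 0) = m + 1)
    (hinf : finrank ℝ ↥(⨅ k : Fin (m + 1), N.V (0 + (k : ℕ))) = 1) :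
    finrank ℝ (LinearMap.ker Φ) = 1 := by
  have h1 : N.V 0 ⊓ LinearMap.ker Φ ≤ ⨅ k : Fin (m + 1), N.V (0 + (k : ℕ)) :=
    le_iInf fun k x hx => N.mem_V_of_mem_ker hV hedge hx.2 hx.1 k
  have h2 := Submodule.finrank_mono h1
  have h3 := LinearMap.BilinForm.finrank_add_finrank_orthogonal' (B := Φ) (N.V 0)
  have hle := LinearMap.BilinForm.le_orthogonal_self (hV 0)
  have h4 := Submodule.finrank_mono hle
  have h5 : N.V 0 = Φ.orthogonal (N.V 0) := Submodule.eq_of_le_of_finrank_le hle (by omega)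
  have h6 : LinearMap.ker Φ ≤ N.V 0 := by
    rw [h5]
    exact LinearMap.BilinForm.ker_le_orthogonal ⟨hsymm⟩ _
  rw [inf_eq_right.2 h6] at h2 h3
  omega

end InscribedNet

end Corank

/-! ### Signature and systems of generators. -/

section Systems

open Module

variable {m : ℕ} {q : QuadraticForm ℝ (HomCoord (2 * m))}

theorem finrank_homCoord (n : ℕ) : finrank ℝ (HomCoord n) = n + 1 := by simp

theorem IsIsotropic.polarBilin_eq_zero {n : ℕ} {q : QuadraticForm ℝ (HomCoord n)}
    {G : Submodule ℝ (HomCoord n)} (h : IsIsotropic q G) :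
    ∀ x ∈ G, ∀ y ∈ G, QuadraticMap.polarBilin q x y = 0 := by
  intro x hx y hy
  rw [QuadraticMap.polarBilin_apply_apply, QuadraticMap.polar, h _ (G.add_mem hx hy), h x hx,
    h y hy]
  ring

theorem polarBilin_isSymm {n : ℕ} (q : QuadraticForm ℝ (HomCoord n)) :
    LinearMap.BilinForm.IsSymm (QuadraticMap.polarBilin q) :=
  ⟨fun x y => QuadraticMap.polar_comm q x y⟩

/-- An isotropic space of dimension `m + 1` bounds both indices by `m`, and corank one makes them
add up to `2 * m`. -/
theorem hasSignature_of_isotropic {G : Submodule ℝ (HomCoord (2 * m))}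
    (hr : finrank ℝ (QuadraticMap.radical q) = 1) (hG : IsIsotropic q G)
    (hGm : finrank ℝ G = m + 1) : HasSignature q m m 1 := by
  have h1 := QuadraticForm.sigPos_add_finrank_le_of_nonpos (Q := q) (V := G) fun x hx => (hG x hx).le
  have h2 := QuadraticForm.sigPos_add_finrank_le_of_nonpos (Q := -q) (V := G) fun x hx => by
    simp [hG x hx]
  rw [sigPos_neg] at h2
  have h3 := QuadraticForm.sigPos_add_sigNeg_add_radical (Q := q)
  rw [finrank_homCoord] at h1 h2 h3
  exact ⟨by omega, by omega, hr⟩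

theorem isGenerator_iff (hr : finrank ℝ (QuadraticMap.radical q) = 1)
    {G₀ : Submodule ℝ (HomCoord (2 * m))} (hG₀ : IsIsotropic q G₀) (hG₀m : finrank ℝ G₀ = m + 1)
    {G : Submodule ℝ (HomCoord (2 * m))} :
    IsGenerator q G ↔ IsIsotropic q G ∧ finrank ℝ G = m + 1 := by
  rw [QuadraticMap.radical_eq_ker_polarBilin] at hr
  have hle : ∀ G', IsIsotropic q G' → finrank ℝ G' ≤ m + 1 := fun G' hG' =>
    LinearMap.BilinForm.finrank_le_of_isotropic (finrank_homCoord _) hr hG'.polarBilin_eq_zero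
  constructor
  · rintro ⟨h1, h2⟩
    have h3 := h2 G₀ hG₀
    have h4 := hle G h1
    simp only [projDim] at h3
    exact ⟨h1, by omega⟩
  · rintro ⟨h1, h2⟩
    refine ⟨h1, fun G' hG' => ?_⟩
    have := hle G' hG'
    simp only [projDim]
    omega

theorem finrank_inf_inf_isCompl {R K F : Submodule ℝ (HomCoord (2 * m))} (hF : IsCompl F R)
    (hRK : R ≤ K) : finrank ℝ ↥(F ⊓ K) + finrank ℝ R = finrank ℝ K := by
  have h1 := Submodule.finrank_sup_add_finrank_inf_eq R (F ⊓ K)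
  have h2 : R ⊔ F ⊓ K = K := by
    rw [← sup_inf_assoc_of_le F hRK, sup_comm, hF.sup_eq_top, top_inf_eq]
  have h3 : R ⊓ (F ⊓ K) = ⊥ := by
    rw [eq_bot_iff, ← hF.symm.inf_eq_bot]
    exact inf_le_inf_left _ inf_le_left
  rw [h2, h3, finrank_bot] at h1
  omega

/-- Both subspaces contain the apex, so cutting with a hyperplane off the apex lowers the dimension
of the intersection by exactly one, whichever hyperplane is used. -/
theorem sameSystem_iff (hr : finrank ℝ (QuadraticMap.radical q) = 1)
    {G₁ G₂ : Submodule ℝ (HomCoord (2 * m))} (h₁ : QuadraticMap.radical q ≤ G₁)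
    (h₂ : QuadraticMap.radical q ≤ G₂) :
    SameSystem q G₁ G₂ ↔ finrank ℝ ↥(G₁ ⊓ G₂) ≡ m + 1 [MOD 2] := by
  have key : ∀ F : Submodule ℝ (HomCoord (2 * m)), IsCompl F (QuadraticMap.radical q) →
      (¬ projDim ((G₁ ⊓ F) ⊓ (G₂ ⊓ F)) ≡ (m : ℤ) [ZMOD 2] ↔
        finrank ℝ ↥(G₁ ⊓ G₂) ≡ m + 1 [MOD 2]) := by
    intro F hF
    have h := finrank_inf_inf_isCompl hF (le_inf h₁ h₂)
    rw [hr] at h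
    have e : (G₁ ⊓ F) ⊓ (G₂ ⊓ F) = F ⊓ (G₁ ⊓ G₂) := by
      rw [← inf_inf_distrib_right, inf_comm]
    rw [e, projDim, ← h]
    simp only [Int.ModEq, Nat.ModEq]
    omega
  obtain ⟨F, hF⟩ := Submodule.exists_isCompl (QuadraticMap.radical q)
  exact ⟨fun h => (key F hF.symm).1 (h F hF.symm), fun h F hF => (key F hF).2 h⟩

/-- A sequence of generators of a quadric of corank one, of which any two consecutive ones meet in
a hyperplane of both, alternates between the two systems of generators. -/
theorem alternatesBetweenSystems (hr : finrank ℝ (QuadraticMap.radical q) = 1)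
    {G : ℤ → Submodule ℝ (HomCoord (2 * m))} (hG : ∀ i, IsIsotropic q (G i))
    (hGm : ∀ i, finrank ℝ (G i) = m + 1)
    (hinf : ∀ i, finrank ℝ ↥(G i ⊓ G (i + 1)) = m) : AlternatesBetweenSystems q G := by
  have gen : ∀ A, IsGenerator q A ↔ IsIsotropic q A ∧ finrank ℝ A = m + 1 := fun A =>
    isGenerator_iff hr (hG 0) (hGm 0)
  have hrad := QuadraticMap.radical_eq_ker_polarBilin (Q := q)
  have orth : ∀ A, IsGenerator q A →
      (LinearMap.BilinForm.orthogonal (QuadraticMap.polarBilin q) A) = A := fun A hA =>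
    LinearMap.BilinForm.orthogonal_eq_self_of_isotropic (finrank_homCoord _) (hrad ▸ hr)
      ((gen A).1 hA).1.polarBilin_eq_zero ((gen A).1 hA).2
  have hle : ∀ A, IsGenerator q A → QuadraticMap.radical q ≤ A := fun A hA => by
    rw [hrad]
    conv_rhs => rw [← orth A hA]
    exact LinearMap.BilinForm.ker_le_orthogonal (polarBilin_isSymm q) A
  have same : ∀ A B, IsGenerator q A → IsGenerator q B →
      (SameSystem q A B ↔ finrank ℝ ↥(A ⊓ B) ≡ m + 1 [MOD 2]) := fun A B hA hB =>
    sameSystem_iff hr (hle A hA) (hle B hB)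
  have parity : ∀ A B C, IsGenerator q A → IsGenerator q B → IsGenerator q C →
      finrank ℝ ↥(A ⊓ B) + finrank ℝ ↥(A ⊓ C) + finrank ℝ ↥(B ⊓ C) ≡ m + 1 [MOD 2] := by
    intro A B C hA hB hC
    have := LinearMap.BilinForm.finrank_inf_add_finrank_inf_modEq (polarBilin_isSymm q)
      (orth A hA) (orth B hB) (orth C hC)
    rwa [((gen A).1 hA).2] at this
  have hgen : ∀ i, IsGenerator q (G i) := fun i => (gen _).2 ⟨hG i, hGm i⟩
  have refl : ∀ A, IsGenerator q A → SameSystem q A A := fun A hA => by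
    rw [same A A hA hA, inf_idem, ((gen A).1 hA).2]
  have step : ∀ i, ¬ SameSystem q (G i) (G (i + 1)) := fun i h => by
    rw [same _ _ (hgen _) (hgen _), hinf] at h
    simp only [Nat.ModEq] at h
    omega
  have system_eq : ∀ A B, IsGenerator q A → IsGenerator q B → SameSystem q A B →
      {C | IsGenerator q C ∧ SameSystem q A C} = {C | IsGenerator q C ∧ SameSystem q B C} := by
    intro A B hA hB hAB
    ext C
    simp only [Set.mem_ofPred_eq, and_congr_right_iff]
    intro hC
    have h := parity A B C hA hB hC
    rw [same A B hA hB] at hAB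
    rw [same A C hA hC, same B C hB hC]
    simp only [Nat.ModEq] at *
    omega
  -- Two of the three intersections have dimension `m`, so the parity lemma forces the third to be
  -- `m + 1` modulo two.
  have two_step : ∀ i, SameSystem q (G i) (G (i + 1 + 1)) := by
    intro i
    have h := parity _ _ _ (hgen i) (hgen (i + 1)) (hgen (i + 1 + 1))
    rw [same _ _ (hgen _) (hgen _)]
    rw [hinf, hinf] at h
    simp only [Nat.ModEq] at *
    omega
  have trans : ∀ A B C, IsGenerator q A → IsGenerator q B → IsGenerator q C →
      SameSystem q A B → SameSystem q B C → SameSystem q A C := by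
    intro A B C hA hB hC hAB hBC
    have h : C ∈ {C | IsGenerator q C ∧ SameSystem q A C} := by
      rw [system_eq A B hA hB hAB]; exact ⟨hC, hBC⟩
    exact h.2
  have symm : ∀ A B, IsGenerator q A → IsGenerator q B → SameSystem q A B → SameSystem q B A := by
    intro A B hA hB hAB
    rw [same A B hA hB] at hAB
    rwa [same B A hB hA, inf_comm]
  have even : ∀ k i : ℤ, SameSystem q (G k) (G (2 * i + k)) := by
    intro k i
    induction i using Int.induction_on with
    | zero => simpa using refl _ (hgen k)
    | succ i ih =>
      have h := two_step (2 * i + k)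
      rw [show 2 * (i : ℤ) + k + 1 + 1 = 2 * (i + 1) + k by ring] at h
      exact trans _ _ _ (hgen _) (hgen _) (hgen _) ih h
    | pred i ih =>
      have h := two_step (2 * (-i - 1) + k)
      rw [show 2 * (-(i : ℤ) - 1) + k + 1 + 1 = 2 * (-i) + k by ring] at h
      exact trans _ _ _ (hgen _) (hgen _) (hgen _) ih (symm _ _ (hgen _) (hgen _) h)
  refine ⟨{C | IsGenerator q C ∧ SameSystem q (G 0) C}, {C | IsGenerator q C ∧ SameSystem q (G 1) C},
    ⟨G 0, hgen 0, rfl⟩, ⟨G 1, hgen 1, rfl⟩, fun h => ?_, ?_, fun i => ⟨hgen _, ?_⟩,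
    fun i => ⟨hgen _, even 1 i⟩⟩
  · have h1 : G 1 ∈ {C | IsGenerator q C ∧ SameSystem q (G 0) C} := by
      rw [h]; exact ⟨hgen 1, refl _ (hgen 1)⟩
    exact step 0 h1.2
  · rintro _ ⟨A, hA, rfl⟩
    by_cases h0 : SameSystem q A (G 0)
    · exact Or.inl (system_eq _ _ hA (hgen 0) h0)
    · refine Or.inr (system_eq _ _ hA (hgen 1) ?_)
      -- Since `G 0 ⊓ G 1` has dimension `m`, the intersections of `A` with `G 0` and with `G 1`
      -- have opposite parities: `A` belongs to exactly one of the two systems.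
      have h := parity A (G 0) (G 1) hA (hgen 0) (hgen 1)
      have h01 := hinf 0
      rw [zero_add] at h01
      rw [same _ _ hA (hgen _)] at h0 ⊢
      rw [h01] at h
      simp only [Nat.ModEq] at *
      omega
  · simpa using even 0 i

end Systems

/-! ### From the projective net to vectors, and the two quadrics. -/

section Quadrics

open Module

/-- The form `q` is not tied to `N.form`, so that this applies both to `𝒱` with the net and to `ℋ`
with the interchanged net. -/
theorem InscribedNet.hasSignature_and_alternatesBetweenSystems {m : ℕ}
    (N : InscribedNet (HomCoord (2 * m))) {q : QuadraticForm ℝ (HomCoord (2 * m))}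
    (hq : ∀ i, IsIsotropic q (N.V i))
    (hedge : ∀ i j, QuadraticMap.polarBilin q (N.p i j) (N.p (i + 1) j) ≠ 0)
    (hVm : ∀ i, finrank ℝ (N.V i) = m + 1)
    (hinf : finrank ℝ ↥(⨅ k : Fin (m + 1), N.V (0 + (k : ℕ))) = 1) :
    HasSignature q m m 1 ∧ AlternatesBetweenSystems q N.V := by
  have hr : finrank ℝ (QuadraticMap.radical q) = 1 := by
    rw [QuadraticMap.radical_eq_ker_polarBilin]
    exact N.finrank_ker_eq_one (finrank_homCoord _) (fun x y => QuadraticMap.polar_comm q x y)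
      (fun i => (hq i).polarBilin_eq_zero) hedge (hVm 0) hinf
  exact ⟨hasSignature_of_isotropic hr (hq 0) (hVm 0),
    alternatesBetweenSystems hr hq hVm fun i => N.finrank_V_inf_V_succ (hVm i)⟩

theorem eq_zero_of_finrank_sup_span_eq_three {E : Type*} [AddCommGroup E] [Module ℝ E]
    {x y z : E} (h : finrank ℝ ↥(Submodule.span ℝ {x} ⊔ Submodule.span ℝ {y} ⊔
      Submodule.span ℝ {z}) = 3) {r s t : ℝ} (hrel : r • x + s • y + t • z = 0) :
    r = 0 ∧ s = 0 ∧ t = 0 := by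
  have hli : LinearIndependent ℝ ![x, y, z] := by
    rw [linearIndependent_iff_card_eq_finrank_span, Set.finrank, Fintype.card_fin]
    have hspan : Submodule.span ℝ (Set.range ![x, y, z]) =
        Submodule.span ℝ {x} ⊔ Submodule.span ℝ {y} ⊔ Submodule.span ℝ {z} := by
      rw [← Submodule.span_union, ← Submodule.span_union]
      congr 1
      ext v
      simp [or_comm, or_left_comm]
    rw [hspan, h]
  have := Fintype.linearIndependent_iff.1 hli ![r, s, t] (by
    simpa [Fin.sum_univ_three] using hrel)
  exact ⟨this 0, this 1, this 2⟩

/-- Four points in a plane of which no three are collinear satisfy a linear dependency with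
non-zero coefficients. -/
theorem exists_quad_relation {E : Type*} [AddCommGroup E] [Module ℝ E] {x y z w : E}
    (h : finrank ℝ ↥(Submodule.span ℝ {x} ⊔ Submodule.span ℝ {y} ⊔ Submodule.span ℝ {z} ⊔
      Submodule.span ℝ {w}) ≤ 3)
    (hxyw : finrank ℝ ↥(Submodule.span ℝ {x} ⊔ Submodule.span ℝ {y} ⊔ Submodule.span ℝ {w}) = 3)
    (hxyz : finrank ℝ ↥(Submodule.span ℝ {x} ⊔ Submodule.span ℝ {y} ⊔ Submodule.span ℝ {z}) = 3)
    (hxwz : finrank ℝ ↥(Submodule.span ℝ {x} ⊔ Submodule.span ℝ {w} ⊔ Submodule.span ℝ {z}) = 3)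
    (hywz : finrank ℝ ↥(Submodule.span ℝ {y} ⊔ Submodule.span ℝ {w} ⊔ Submodule.span ℝ {z}) = 3) :
    ∃ a b c d : ℝ, a ≠ 0 ∧ b ≠ 0 ∧ c ≠ 0 ∧ d ≠ 0 ∧ a • x + b • y + c • z + d • w = 0 := by
  have hnli : ¬ LinearIndependent ℝ ![x, y, z, w] := by
    intro hli
    have hcard := finrank_span_eq_card hli
    have hspan : Submodule.span ℝ (Set.range ![x, y, z, w]) =
        Submodule.span ℝ {x} ⊔ Submodule.span ℝ {y} ⊔ Submodule.span ℝ {z} ⊔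
          Submodule.span ℝ {w} := by
      rw [← Submodule.span_union, ← Submodule.span_union, ← Submodule.span_union]
      congr 1
      ext v
      simp [or_comm, or_left_comm]
    rw [hspan, Fintype.card_fin] at hcard
    omega
  obtain ⟨g, hsum, k, hk⟩ := Fintype.not_linearIndependent_iff.1 hnli
  have hrel : g 0 • x + g 1 • y + g 2 • z + g 3 • w = 0 := by
    simpa [Fin.sum_univ_four] using hsum
  have all : ¬ (g 0 = 0 ∧ g 1 = 0 ∧ g 2 = 0 ∧ g 3 = 0) := by
    rintro ⟨h0, h1, h2, h3⟩
    fin_cases k <;> simp_all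
  -- If one coefficient vanished, the other three vertices, being independent, would force all
  -- coefficients to vanish.
  refine ⟨g 0, g 1, g 2, g 3, fun h0 => ?_, fun h1 => ?_, fun h2 => ?_, fun h3 => ?_, hrel⟩
  · have := eq_zero_of_finrank_sup_span_eq_three hywz (r := g 1) (s := g 3) (t := g 2) (by
      rw [← hrel, h0]; module)
    exact all ⟨h0, this.1, this.2.2, this.2.1⟩
  · have := eq_zero_of_finrank_sup_span_eq_three hxwz (r := g 0) (s := g 3) (t := g 2) (by
      rw [← hrel, h1]; module)
    exact all ⟨this.1, h1, this.2.2, this.2.1⟩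
  · have := eq_zero_of_finrank_sup_span_eq_three hxyw (r := g 0) (s := g 1) (t := g 3) (by
      rw [← hrel, h2]; module)
    exact all ⟨this.1, this.2.1, h2, this.2.2⟩
  · have := eq_zero_of_finrank_sup_span_eq_three hxyz (r := g 0) (s := g 1) (t := g 2) (by
      rw [← hrel, h3]; module)
    exact all ⟨this.1, this.2.1, this.2.2, h3⟩

theorem polarBilin_ne_zero_of_not_isIsotropic {n : ℕ} {q : QuadraticForm ℝ (HomCoord n)}
    {x y : HomCoord n} (hx : q x = 0) (hy : q y = 0)
    (h : ¬ IsIsotropic q (Submodule.span ℝ {x} ⊔ Submodule.span ℝ {y})) :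
    QuadraticMap.polarBilin q x y ≠ 0 := by
  intro h0
  apply h
  intro z hz
  obtain ⟨u, hu, v, hv, rfl⟩ := Submodule.mem_sup.1 hz
  obtain ⟨s, rfl⟩ := Submodule.mem_span_singleton.1 hu
  obtain ⟨t, rfl⟩ := Submodule.mem_span_singleton.1 hv
  rw [QuadraticMap.polarBilin_apply_apply] at h0
  rw [QuadraticMap.map_add q, QuadraticMap.map_smul, QuadraticMap.map_smul,
    QuadraticMap.polar_smul_left, QuadraticMap.polar_smul_right, hx, hy, h0]
  simp

/-- The span of `m + 1` vertices of a parameter line is the span of the whole line. -/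
theorem rowSpan_rep_eq {m : ℕ} {P : ℤ → ℤ → RP (2 * m)} {i : ℤ}
    {W : Submodule ℝ (HomCoord (2 * m))} (hW : projDim W = m)
    (hPW : ∀ j, (P i j).submodule ≤ W)
    (hjoin : projDim (⨆ k : Fin (m + 1), (P i (0 + (k : ℕ))).submodule) = m) :
    rowSpan (fun i j => (P i j).rep) i = W := by
  have hmem : ∀ j, (P i j).rep ∈ (P i j).submodule := fun j => by
    rw [Projectivization.submodule_eq]; exact Submodule.mem_span_singleton_self _
  have h1 : rowSpan (fun i j => (P i j).rep) i ≤ W := rowSpan_le fun j => hPW j (hmem j)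
  have h2 : ⨆ k : Fin (m + 1), (P i (0 + (k : ℕ))).submodule ≤
      rowSpan (fun i j => (P i j).rep) i := by
    refine iSup_le fun k => ?_
    rw [Projectivization.submodule_eq, Submodule.span_singleton_le_iff_mem]
    exact mem_rowSpan (fun i j => (P i j).rep) i _
  have h3 := Submodule.finrank_mono h2
  refine Submodule.eq_of_le_of_finrank_le h1 ?_
  simp only [projDim] at hW hjoin
  omega

theorem exists_inscribedNet {m : ℕ} {Q : QuadraticForm ℝ (HomCoord (2 * m))}
    {P : ℤ → ℤ → RP (2 * m)} (hP : IsQNet P) (hPQ : ∀ i j : ℤ, IsIsotropic Q (P i j).submodule)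
    {V H : ℤ → Submodule ℝ (HomCoord (2 * m))}
    (hVdim : ∀ i : ℤ, projDim (V i) = m) (hHdim : ∀ j : ℤ, projDim (H j) = m)
    (hPV : ∀ i j : ℤ, (P i j).submodule ≤ V i) (hPH : ∀ i j : ℤ, (P i j).submodule ≤ H j)
    (hgen : IsGenericNet Q P V H) :
    ∃ N : InscribedNet (HomCoord (2 * m)),
      N.form = QuadraticMap.polarBilin Q ∧ N.V = V ∧ N.H = H := by
  let p : ℤ → ℤ → HomCoord (2 * m) := fun i j => (P i j).rep
  have hsub : ∀ i j, (P i j).submodule = Submodule.span ℝ {p i j} := fun i j =>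
    Projectivization.submodule_eq _
  have hV : ∀ i, rowSpan p i = V i := fun i =>
    rowSpan_rep_eq (hVdim i) (hPV i) (hgen.join_V i 0)
  have hH : ∀ j, rowSpan (fun i j => p j i) j = H j := fun j =>
    rowSpan_rep_eq (P := fun i j => P j i) (hHdim j) (fun i => hPH i j) (hgen.join_H 0 j)
  have hiso : ∀ i j, Q (p i j) = 0 := fun i j => hPQ i j _ (by
    rw [hsub]; exact Submodule.mem_span_singleton_self _)
  have hquad : ∀ i j, ∃ a b c d : ℝ, a ≠ 0 ∧ b ≠ 0 ∧ c ≠ 0 ∧ d ≠ 0 ∧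
      a • p i j + b • p (i + 1) j + c • p (i + 1) (j + 1) + d • p i (j + 1) = 0 := by
    intro i j
    have h0 := hP i j
    have h1 := hgen.quad₁ i j
    have h2 := hgen.quad₂ i j
    have h3 := hgen.quad₃ i j
    have h4 := hgen.quad₄ i j
    simp only [hsub] at h0 h1 h2 h3 h4
    simp only [projDim] at h0 h1 h2 h3 h4
    exact exists_quad_relation (by omega) (by omega) (by omega) (by omega) (by omega)
  choose a b c d ha hb hc hd hrel using hquad
  let g : GridCoeffs := ⟨a, b, c, d, ha, hb, hc, hd⟩
  have hg : g.Rel p := hrel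
  have htop : Submodule.span ℝ (Set.range fun z : ℤ × ℤ => p z.1 z.2) = ⊤ := by
    rw [eq_top_iff, ← hgen.span_eq_top]
    refine iSup_le fun i => iSup_le fun j => ?_
    rw [hsub, Submodule.span_singleton_le_iff_mem]
    exact Submodule.subset_span ⟨(i, j), rfl⟩
  have hinf : ∀ i j, rowSpan p i ⊓ rowSpan (fun i j => p j i) j ≤ Submodule.span ℝ {p i j} := by
    intro i j
    have hsup : rowSpan p i ⊔ rowSpan (fun i j => p j i) j = ⊤ := by
      rw [eq_top_iff, ← htop, Submodule.span_le]
      rintro _ ⟨z, rfl⟩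
      exact hg.mem_rowSpan_sup i j z.1 z.2
    have hdim := Submodule.finrank_sup_add_finrank_inf_eq (rowSpan p i)
      (rowSpan (fun i j => p j i) j)
    have hle : Submodule.span ℝ {p i j} ≤ rowSpan p i ⊓ rowSpan (fun i j => p j i) j := by
      rw [Submodule.span_singleton_le_iff_mem]
      exact ⟨mem_rowSpan p i j, mem_rowSpan (fun i j => p j i) j i⟩
    -- The dimension is `(m + 1) + (m + 1) - (2 * m + 1) = 1`.
    refine (Submodule.eq_of_le_of_finrank_le hle ?_).ge
    have h1 := hVdim i
    have h2 := hHdim j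
    simp only [projDim] at h1 h2
    rw [hsup, finrank_top, finrank_homCoord, hV, hH] at hdim
    rw [finrank_span_singleton (Projectivization.rep_nonzero _), hV, hH]
    omega
  refine ⟨⟨g, QuadraticMap.polarBilin Q, p, fun x y => QuadraticMap.polar_comm Q x y, hg, ?_, ?_,
    ?_, hinf, htop⟩, rfl, funext hV, funext hH⟩
  · intro i j
    rw [QuadraticMap.polarBilin_apply_apply, QuadraticMap.polar_self, hiso, smul_zero]
  · intro i j
    refine polarBilin_ne_zero_of_not_isIsotropic (hiso _ _) (hiso _ _) ?_
    rw [← hsub, ← hsub]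
    exact hgen.edge_V i j
  · intro i j
    refine polarBilin_ne_zero_of_not_isIsotropic (hiso _ _) (hiso _ _) ?_
    rw [← hsub, ← hsub]
    exact hgen.edge_H i j

end Quadrics

/-! ### Assembly of the two quadrics and the pencil. -/

theorem mainTheorem6 (m : ℕ) (hm : 2 ≤ m)
    (Q : QuadraticForm ℝ (HomCoord (2 * m))) (hQ : (QuadraticMap.polarBilin Q).Nondegenerate)
    (P : ℤ → ℤ → RP (2 * m)) (hP : IsQNet P)
    (hPQ : ∀ i j : ℤ, IsIsotropic Q (P i j).submodule)
    (V H : ℤ → Submodule ℝ (HomCoord (2 * m)))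
    (hVdim : ∀ i : ℤ, projDim (V i) = m) (hHdim : ∀ j : ℤ, projDim (H j) = m)
    (hPV : ∀ i j : ℤ, (P i j).submodule ≤ V i) (hPH : ∀ i j : ℤ, (P i j).submodule ≤ H j)
    (hgen : IsGenericNet Q P V H) :
    ∃ 𝒱 ℋ : QuadraticForm ℝ (HomCoord (2 * m)),
      (HasSignature 𝒱 m m 1 ∧ ∀ i : ℤ, IsIsotropic 𝒱 (V i)) ∧
      (HasSignature ℋ m m 1 ∧ ∀ j : ℤ, IsIsotropic ℋ (H j)) ∧
      AlternatesBetweenSystems 𝒱 V ∧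
      AlternatesBetweenSystems ℋ H ∧
      ∃ L : Submodule ℝ (QuadraticForm ℝ (HomCoord (2 * m))),
        IsPencil L ∧ Q ∈ L ∧ 𝒱 ∈ L ∧ ℋ ∈ L := by
  obtain ⟨N, hform, rfl, rfl⟩ := exists_inscribedNet hP hPQ hVdim hHdim hPV hPH hgen
  obtain ⟨Φ, hsymm, hΦV, hΦH⟩ := N.exists_symmetric_form
  -- The factor `1 / 2` makes `Φ` the polar form of `𝒱`, matching `N.form` as the polar form of `Q`.
  let 𝒱 : QuadraticForm ℝ (HomCoord (2 * m)) := (1 / 2 : ℝ) • LinearMap.BilinMap.toQuadraticMap Φ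
  have h𝒱 : ∀ x, 𝒱 x = 1 / 2 * Φ x x := fun x => rfl
  have hpolar : ∀ x y, QuadraticMap.polarBilin 𝒱 x y = Φ x y := by
    intro x y
    rw [QuadraticMap.polarBilin_apply_apply, QuadraticMap.polar, h𝒱, h𝒱, h𝒱]
    simp only [map_add, LinearMap.add_apply]
    rw [hsymm y x]
    ring
  have hQform : ∀ x, Q x = 1 / 2 * N.form x x := by
    intro x
    rw [hform, QuadraticMap.polarBilin_apply_apply, QuadraticMap.polar_self]
    simp
  have hpolar' : ∀ x y, QuadraticMap.polarBilin (Q - 𝒱) x y = N.form x y - Φ x y := by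
    intro x y
    rw [hform, ← hpolar]
    simp only [QuadraticMap.polarBilin_apply_apply, QuadraticMap.polar, sub_apply]
    ring
  have hVm : ∀ i, Module.finrank ℝ (N.V i) = m + 1 := fun i => by
    have := hVdim i
    simp only [projDim] at this
    omega
  have hHm : ∀ j, Module.finrank ℝ (N.swap.V j) = m + 1 := fun j => by
    have := hHdim j
    simp only [projDim] at this
    change Module.finrank ℝ (N.H j) = m + 1
    omega
  have h𝒱V : ∀ i, IsIsotropic 𝒱 (N.V i) := fun i x hx => by
    rw [h𝒱, hΦV i x hx x hx, mul_zero]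
  have hℋH : ∀ j, IsIsotropic (Q - 𝒱) (N.swap.V j) := fun j x hx => by
    rw [sub_apply, h𝒱, hQform, hΦH j x hx x hx, sub_self]
  -- Edges between consecutive `V i` lie in some `H j`, where `Φ` equals the form of `Q`; hence they
  -- are not isotropic for `𝒱`. For `Q - 𝒱` the roles are exchanged.
  have hV := N.hasSignature_and_alternatesBetweenSystems h𝒱V (fun i j => by
    rw [hpolar, hΦH j _ (N.mem_H i j) _ (N.mem_H (i + 1) j)]
    exact N.edge_col i j) hVm (by
    have := hgen.inter_V 0
    simp only [projDim] at this
    omega)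
  have hH := N.swap.hasSignature_and_alternatesBetweenSystems hℋH (fun i j => by
    change QuadraticMap.polarBilin (Q - 𝒱) (N.p j i) (N.p j (i + 1)) ≠ 0
    rw [hpolar', hΦV j _ (N.mem_V j i) _ (N.mem_V j (i + 1)), sub_zero]
    exact N.edge_row j i) hHm (by
    have := hgen.inter_H 0
    simp only [projDim] at this
    change Module.finrank ℝ ↥(⨅ k : Fin (m + 1), N.H (0 + (k : ℕ))) = 1
    omega)
  refine ⟨𝒱, Q - 𝒱, ⟨hV.1, h𝒱V⟩, ⟨hH.1, hℋH⟩, hV.2, hH.2, Submodule.span ℝ (Set.range ![Q, 𝒱]),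
    ?_, Submodule.subset_span ⟨0, rfl⟩, Submodule.subset_span ⟨1, rfl⟩,
    sub_mem (Submodule.subset_span ⟨0, rfl⟩) (Submodule.subset_span ⟨1, rfl⟩)⟩
  have hli : LinearIndependent ℝ ![Q, 𝒱] := by
    rw [LinearIndependent.pair_iff]
    intro s t hst
    have h : ∀ x y, s * N.form x y + t * Φ x y = 0 := by
      intro x y
      have := congrArg (fun q => QuadraticMap.polarBilin q x y) hst
      rw [hform, ← hpolar]
      simp only [QuadraticMap.polarBilin_apply_apply, QuadraticMap.polar, add_apply,
        smul_apply, zero_apply, smul_eq_mul] at this ⊢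
      linarith
    -- An edge inside `V 0` is isotropic for `𝒱` but not for `Q`, which kills `s`; an edge inside `H
    -- 0` then kills `t`.
    have hs : s = 0 := by
      have h1 := h (N.p 0 0) (N.p 0 (0 + 1))
      rw [hΦV 0 _ (N.mem_V 0 0) _ (N.mem_V 0 (0 + 1)), mul_zero, add_zero] at h1
      exact (mul_eq_zero.1 h1).resolve_right (N.edge_row 0 0)
    have h2 := h (N.p 0 0) (N.p (0 + 1) 0)
    rw [hs, hΦH 0 _ (N.mem_H 0 0) _ (N.mem_H (0 + 1) 0), zero_mul, zero_add] at h2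
    exact ⟨hs, (mul_eq_zero.1 h2).resolve_right (N.edge_col 0 0)⟩
  rw [IsPencil, finrank_span_eq_card hli, Fintype.card_fin]
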